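/- Let $n\ge 1$ and let $M$ be a paracompact (Hausdorff) $C^\infty$ manifold of dimension $2n$; all objects below are of class $C^\infty$. Brackets are Frölicher–Nijenhuis brackets: for vector fields $X,Y$ and vector $1$-forms (fields of endomorphisms of $TM$) $K,N$, $[X,K]Y=[X,KY]-K[X,Y]$, $[K,X]=-[X,K]$, and $$[K,N](X,Y)=[KX,NY]+[NX,KY]+KN[X,Y]+NK[X,Y]-K[NX,Y]-K[X,NY]-N[KX,Y]-N[X,KY].$$ Let $L$ be a vector $1$-form on $M$ with $[L,L]=0$ and $\operatorname{Im}(L_z)=\operatorname{Ker}(L_z)$ for every $z\in M$ (so $L$ has constant rank $n$), and let $C$ be a vector field on $M$ (the canonical vector field) such that every point of $M$ lies in the domain of a chart $(x^1,\dots,x^n,y^1,\dots,y^n)$ in which $$L\frac{\partial}{\partial x^i}=\frac{\partial}{\partial y^i},\qquad L\frac{\partial}{\partial y^i}=0,\qquad C=\sum_i y^i\frac{\partial}{\partial y^i}.$$ An $L$-connection is a vector $1$-form $\Gamma$ on $M$ with $L\Gamma=L$ and $\Gamma L=-L$; it is homogeneous if $[C,\Gamma]=0$. An $L$-spray is a vector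 field $G$ on $M$ with $LG=C$ and $[C,G]=G$. A homogeneous $L$-connection $\Gamma$ is conservative if $\Gamma=[L,G]$ for some $L$-spray $G$. The torsion of $\Gamma$ is $T=\frac12[L,\Gamma]$. Theorem 4. A homogeneous $L$-connection $\Gamma$ on $M$ is conservative if and only if $[L,\Gamma]=0$, i.e. if and only if its torsion $T$ vanishes. -/

import Mathlib

open scoped Manifold ContDiff

noncomputable section

/-- Smooth vector fields on a `2n`-dimensional manifold `M` (charts with values in `ℝⁿ⁺ⁿ`). -/
abbrev VField (n : ℕ) (M : Type*) [TopologicalSpace M]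
    [ChartedSpace (EuclideanSpace ℝ (Fin (n + n))) M] [IsManifold (𝓡 (n + n)) ∞ M] : Type _ :=
  ContMDiffSection (𝓡 (n + n)) (EuclideanSpace ℝ (Fin (n + n))) ∞
    (fun z : M => TangentSpace (𝓡 (n + n)) z)

/-- Smooth vector `1`-forms on `M`, i.e. smooth sections `z ↦ (K z : T_z M → T_z M)` of the bundle
of endomorphisms of the tangent bundle. -/
abbrev VForm (n : ℕ) (M : Type*) [TopologicalSpace M]
    [ChartedSpace (EuclideanSpace ℝ (Fin (n + n))) M] [IsManifold (𝓡 (n + n)) ∞ M] : Type _ :=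
  ContMDiffSection (𝓡 (n + n))
    (EuclideanSpace ℝ (Fin (n + n)) →L[ℝ] EuclideanSpace ℝ (Fin (n + n))) ∞
    (fun z : M => TangentSpace (𝓡 (n + n)) z →L[ℝ] TangentSpace (𝓡 (n + n)) z)

section

variable {n : ℕ} {M : Type*} [TopologicalSpace M]
  [ChartedSpace (EuclideanSpace ℝ (Fin (n + n))) M] [IsManifold (𝓡 (n + n)) ∞ M]

/-- The vector field `K X : z ↦ K_z (X_z)`. -/
def VForm.app (K : VForm n M) (X : VField n M) : VField n M where
  toFun z := K z (X z)
  contMDiff_toFun := ContMDiff.clm_bundle_apply K.contMDiff X.contMDiff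

/-- The Lie bracket `[X, Y]` of two vector fields. -/
def lieBr (X Y : VField n M) : VField n M where
  toFun z := VectorField.mlieBracket (𝓡 (n + n)) (fun w => X w) (fun w => Y w) z
  contMDiff_toFun := by
    have : IsManifold (𝓡 (n + n)) (((⊤ : ℕ∞) : ℕ∞ω) + 1) M := by
      simpa using (inferInstance : IsManifold (𝓡 (n + n)) ∞ M)
    have : IsManifold (𝓡 (n + n)) (minSmoothness ℝ 2) M := by
      simpa using IsManifold.of_le (I := 𝓡 (n + n)) (M := M) (m := 2) (n := ∞)
        (by norm_cast)
    exact ContDiff.mlieBracket_vectorField (m := ⊤) (n := ⊤) X.contMDiff Y.contMDiff (by simp)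

/-- The Frölicher–Nijenhuis bracket `[X, K]` of a vector field and a vector `1`-form (the Lie
derivative of `K` along `X`), as a map of vector fields: `[X, K] Y = [X, K Y] - K [X, Y]`. -/
def fnFieldForm (X : VField n M) (K : VForm n M) (Y : VField n M) : VField n M :=
  lieBr X (K.app Y) - K.app (lieBr X Y)

/-- The Frölicher–Nijenhuis bracket `[K, X] = -[X, K]` of a vector `1`-form and a vector field, as
a map of vector fields: `[K, X] Y = [K Y, X] - K [Y, X]`. -/
def fnFormField (K : VForm n M) (X : VField n M) (Y : VField n M) : VField n M :=
  lieBr (K.app Y) X - K.app (lieBr Y X)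

/-- The Frölicher–Nijenhuis bracket `[K, N]` of two vector `1`-forms, a vector `2`-form, given by
its values on vector fields. -/
def fnFormForm (K N : VForm n M) (X Y : VField n M) : VField n M :=
  lieBr (K.app X) (N.app Y) + lieBr (N.app X) (K.app Y)
    + K.app (N.app (lieBr X Y)) + N.app (K.app (lieBr X Y))
    - K.app (lieBr (N.app X) Y) - K.app (lieBr X (N.app Y))
    - N.app (lieBr (K.app X) Y) - N.app (lieBr X (K.app Y))

/-- `dcoord e w v k` is the `k`-th component, in the chart `e`, of the tangent vector `v` at `w`.
The coordinates are `(x¹, …, xⁿ, y¹, …, yⁿ)`: the index `Fin.castAdd n i` belongs to `xⁱ` and the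
index `Fin.natAdd n i` to `yⁱ`. -/
def dcoord (e : OpenPartialHomeomorph M (EuclideanSpace ℝ (Fin (n + n)))) (w : M)
    (v : TangentSpace (𝓡 (n + n)) w) (k : Fin (n + n)) : ℝ :=
  let u : EuclideanSpace ℝ (Fin (n + n)) := mfderiv (𝓡 (n + n)) (𝓡 (n + n)) e w v
  u k

/-- A smooth chart `e = (x, y)` is natural for `(L, C)` if on its domain
`L (∂/∂xⁱ) = ∂/∂yⁱ`, `L (∂/∂yⁱ) = 0` (that is, `L (Xⁱ ∂/∂xⁱ + Yⁱ ∂/∂yⁱ) = Xⁱ ∂/∂yⁱ`) and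
`C = yⁱ ∂/∂yⁱ`. -/
structure IsNaturalChart (L : VForm n M) (C : VField n M)
    (e : OpenPartialHomeomorph M (EuclideanSpace ℝ (Fin (n + n)))) : Prop where
  mem_atlas : e ∈ IsManifold.maximalAtlas (𝓡 (n + n)) ∞ M
  L_x : ∀ w ∈ e.source, ∀ (v : TangentSpace (𝓡 (n + n)) w) (i : Fin n),
    dcoord e w (L w v) (Fin.castAdd n i) = 0
  L_y : ∀ w ∈ e.source, ∀ (v : TangentSpace (𝓡 (n + n)) w) (i : Fin n),
    dcoord e w (L w v) (Fin.natAdd n i) = dcoord e w v (Fin.castAdd n i)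
  C_x : ∀ w ∈ e.source, ∀ i : Fin n, dcoord e w (C w) (Fin.castAdd n i) = 0
  C_y : ∀ w ∈ e.source, ∀ i : Fin n, dcoord e w (C w) (Fin.natAdd n i) = e w (Fin.natAdd n i)

/-- `L` is an integrable almost-tangent structure on `M` with canonical vector field `C`. -/
structure IsLStructure (L : VForm n M) (C : VField n M) : Prop where
  nijenhuis : ∀ X Y : VField n M, fnFormForm L L X Y = 0
  range_eq_ker : ∀ z : M, LinearMap.range (L z).toLinearMap = LinearMap.ker (L z).toLinearMap
  natural_chart : ∀ z : M, ∃ e : OpenPartialHomeomorph M (EuclideanSpace ℝ (Fin (n + n))),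
    z ∈ e.source ∧ IsNaturalChart L C e

/-- `L`-connections: `L Γ = L` and `Γ L = -L`. -/
structure IsLConnection (L Γ : VForm n M) : Prop where
  left : ∀ z : M, (L z).comp (Γ z) = L z
  right : ∀ z : M, (Γ z).comp (L z) = -L z

/-- A vector `1`-form is homogeneous of degree one: `[C, Γ] = 0`. -/
def IsHomogeneousOne (C : VField n M) (Γ : VForm n M) : Prop :=
  ∀ X : VField n M, fnFieldForm C Γ X = 0

/-- `L`-semisprays: `L S = C`. -/
def IsLSemispray (L : VForm n M) (C S : VField n M) : Prop := L.app S = C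

/-- `L`-sprays: semisprays that are homogeneous of degree two, `[C, S] = S`. -/
def IsLSpray (L : VForm n M) (C S : VField n M) : Prop :=
  IsLSemispray L C S ∧ lieBr C S = S

/-- `Γ` is conservative: `Γ = [L, G]` for some `L`-spray `G`. -/
def IsConservative (L : VForm n M) (C : VField n M) (Γ : VForm n M) : Prop :=
  ∃ G : VField n M, IsLSpray L C G ∧ ∀ X : VField n M, Γ.app X = fnFormField L G X

/-- The torsion `T = ½ [L, Γ]` of `Γ`. -/
def torsion (L Γ : VForm n M) (X Y : VField n M) : VField n M :=
  (1 / 2 : ℝ) • fnFormForm L Γ X Y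

end

end

/-! ### The Lie ring of vector fields and the action of vector forms on it. -/

section

variable {n : ℕ} {M : Type*} [TopologicalSpace M]
  [ChartedSpace (EuclideanSpace ℝ (Fin (n + n))) M] [IsManifold (𝓡 (n + n)) ∞ M]

/-! If `Γ = [L, G]`, graded Jacobi turns `[L, Γ]` into `½ [[L, L], G] = 0`; this is
`bracket_bracket_eq_zero`, valid in any Lie ring. Conversely, the candidate `G` is the horizontal
semispray `½ (S + Γ S)`, independent of the semispray `S`: two semisprays differ by a field in `Ker
L = Im L`, where `Γ = -1`. Homogeneity of `Γ` makes it a spray. Evaluating `[L, Γ]` on `(X, G)` then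
gives `2 ([L, G] X - Γ X)`. The only input from coordinates is `L [V, S] = V` for vertical `V`
(`app_lieBr_semispray`) and local existence of semisprays. -/

theorem isManifold_minSmoothness_three (n : ℕ) (M : Type*) [TopologicalSpace M]
    [ChartedSpace (EuclideanSpace ℝ (Fin (n + n))) M] [IsManifold (𝓡 (n + n)) ∞ M] :
    IsManifold (𝓡 (n + n)) (minSmoothness ℝ 3) M := by
  simpa using IsManifold.of_le (I := 𝓡 (n + n)) (M := M) (m := 3) (n := ∞) (by norm_cast)

theorem isManifold_minSmoothness_two (n : ℕ) (M : Type*) [TopologicalSpace M]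
    [ChartedSpace (EuclideanSpace ℝ (Fin (n + n))) M] [IsManifold (𝓡 (n + n)) ∞ M] :
    IsManifold (𝓡 (n + n)) (minSmoothness ℝ 2) M := by
  simpa using IsManifold.of_le (I := 𝓡 (n + n)) (M := M) (m := 2) (n := ∞) (by norm_cast)

theorem isManifold_two (n : ℕ) (M : Type*) [TopologicalSpace M]
    [ChartedSpace (EuclideanSpace ℝ (Fin (n + n))) M] [IsManifold (𝓡 (n + n)) ∞ M] :
    IsManifold (𝓡 (n + n)) 2 M :=
  IsManifold.of_le (n := ∞) (by norm_cast)

/-- Smooth vector fields form a Lie ring. -/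
noncomputable instance VField.instLieRing : LieRing (VField n M) where
  bracket := lieBr
  add_lie X Y Z := by
    have := isManifold_two n M
    ext1 z
    exact VectorField.mlieBracket_add_left X.mdifferentiableAt Y.mdifferentiableAt
  lie_add X Y Z := by
    have := isManifold_two n M
    ext1 z
    exact VectorField.mlieBracket_add_right Y.mdifferentiableAt Z.mdifferentiableAt
  lie_self X := by
    ext1 z
    change VectorField.mlieBracket (𝓡 (n + n)) (fun w => X w) (fun w => X w) z = 0
    rw [VectorField.mlieBracket_self]
    rfl
  leibniz_lie X Y Z := by
    have := isManifold_minSmoothness_three n M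
    ext1 z
    have h3 : minSmoothness ℝ 2 ≤ (∞ : WithTop ℕ∞) := by
      simp only [minSmoothness_of_isRCLikeNormedField]
      norm_cast
    exact VectorField.leibniz_identity_mlieBracket_apply ((X.contMDiff z).of_le h3)
      ((Y.contMDiff z).of_le h3) ((Z.contMDiff z).of_le h3)

theorem VField.lie_def (X Y : VField n M) : ⁅X, Y⁆ = lieBr X Y := rfl

/-- The action of a vector `1`-form on vector fields, as an additive map. -/
noncomputable def VForm.toAddHom (K : VForm n M) : VField n M →+ VField n M where
  toFun := K.app
  map_zero' := by
    ext1 z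
    exact map_zero (K z)
  map_add' X Y := by
    ext1 z
    exact map_add (K z) (X z) (Y z)

theorem VForm.app_add (K : VForm n M) (X Y : VField n M) : K.app (X + Y) = K.app X + K.app Y :=
  K.toAddHom.map_add X Y

theorem VForm.app_sub (K : VForm n M) (X Y : VField n M) : K.app (X - Y) = K.app X - K.app Y :=
  K.toAddHom.map_sub X Y

theorem VForm.app_neg (K : VForm n M) (X : VField n M) : K.app (-X) = -K.app X :=
  K.toAddHom.map_neg X

theorem VForm.app_smul (K : VForm n M) (c : ℝ) (X : VField n M) : K.app (c • X) = c • K.app X := by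
  ext1 z
  exact map_smul (K z) c (X z)

end

/-- The graded Jacobi identity `[L, [L, G]] = ½ [[L, L], G]` when `[L, L] = 0` and `L² = 0`. -/
theorem bracket_bracket_eq_zero {A : Type*} [LieRing A] (L : A →+ A) (hLL : ∀ X, L (L X) = 0)
    (hN : ∀ X Y, ⁅L X, L Y⁆ = L ⁅L X, Y⁆ + L ⁅X, L Y⁆) (G : A) (Γ : A → A)
    (hΓ : ∀ X, Γ X = ⁅L X, G⁆ - L ⁅X, G⁆) (X Y : A) :
    ⁅L X, Γ Y⁆ + ⁅Γ X, L Y⁆ + L (Γ ⁅X, Y⁆) + Γ (L ⁅X, Y⁆) - L ⁅Γ X, Y⁆ - L ⁅X, Γ Y⁆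
      - Γ ⁅L X, Y⁆ - Γ ⁅X, L Y⁆ = 0 := by
  -- Bracket the Nijenhuis identity with `G` and expand by Jacobi; `e3` and `e4` are the same
  -- identity with one argument replaced by its bracket with `G`.
  have e1 : ⁅⁅L X, L Y⁆, G⁆ = ⁅L ⁅L X, Y⁆, G⁆ + ⁅L ⁅X, L Y⁆, G⁆ := by rw [hN, add_lie]
  rw [lie_lie] at e1
  have e2 : ⁅⁅L X, G⁆, L Y⁆ = -⁅L Y, ⁅L X, G⁆⁆ := (lie_skew _ _).symm
  have e3 := hN X ⁅Y, G⁆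
  have e4 := hN ⁅X, G⁆ Y
  have e5 : L ⁅⁅L X, Y⁆, G⁆ = L ⁅L X, ⁅Y, G⁆⁆ + L ⁅⁅L X, G⁆, Y⁆ := by
    rw [lie_lie, map_sub, ← lie_skew ⁅L X, G⁆ Y, map_neg, sub_eq_add_neg]
  have e6 : L ⁅⁅X, L Y⁆, G⁆ = L ⁅X, ⁅L Y, G⁆⁆ + L ⁅⁅X, G⁆, L Y⁆ := by
    rw [lie_lie, map_sub, ← lie_skew ⁅X, G⁆ (L Y), map_neg, sub_eq_add_neg]
  simp only [hΓ, lie_sub, sub_lie, map_sub, hLL, zero_lie, e2, e3, e4, e5, e6]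
  rw [sub_eq_iff_eq_add] at e1
  rw [e1]
  abel

/-! ### Components of vector fields in a chart. -/

section

variable {n : ℕ} {M : Type*} [TopologicalSpace M]
  [ChartedSpace (EuclideanSpace ℝ (Fin (n + n))) M]
  {e : OpenPartialHomeomorph M (EuclideanSpace ℝ (Fin (n + n)))}

theorem mdifferentiable_of_mem_maximalAtlas
    (he : e ∈ IsManifold.maximalAtlas (𝓡 (n + n)) ∞ M) :
    e.MDifferentiable (𝓡 (n + n)) (𝓡 (n + n)) :=
  ⟨fun _ hx => ((contMDiffAt_of_mem_maximalAtlas he hx).mdifferentiableAt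
      (by simp)).mdifferentiableWithinAt,
    fun _ hx => ((contMDiffAt_symm_of_mem_maximalAtlas he hx).mdifferentiableAt
      (by simp)).mdifferentiableWithinAt⟩

/-- The components of a vector field in a chart, as a vector field on the model space. -/
noncomputable def chartField (e : OpenPartialHomeomorph M (EuclideanSpace ℝ (Fin (n + n))))
    (X : ∀ z : M, TangentSpace (𝓡 (n + n)) z) :
    EuclideanSpace ℝ (Fin (n + n)) → EuclideanSpace ℝ (Fin (n + n)) :=
  VectorField.mpullback (𝓡 (n + n)) (𝓡 (n + n)) e.symm X

/-- Links the pointwise components used in the hypotheses to a map between vector spaces that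
`fderiv` can act on: the inverse of the derivative of `e.symm` is the derivative of `e`. -/
theorem chartField_apply (he : e ∈ IsManifold.maximalAtlas (𝓡 (n + n)) ∞ M)
    (X : ∀ z : M, TangentSpace (𝓡 (n + n)) z) {z : M} (hz : z ∈ e.source)
    (k : Fin (n + n)) : chartField e X (e z) k = dcoord e z (X z) k := by
  have hd := mdifferentiable_of_mem_maximalAtlas he
  have h1 : (mfderiv (𝓡 (n + n)) (𝓡 (n + n)) e.symm (e z)).inverse =
      mfderiv (𝓡 (n + n)) (𝓡 (n + n)) e (e.symm (e z)) :=
    ContinuousLinearMap.inverse_eq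
      (by
        have := hd.symm_comp_deriv (e.map_target (e.map_source hz))
        rwa [e.right_inv (e.map_source hz)] at this)
      (hd.comp_symm_deriv (e.map_source hz))
  have h2 : chartField e X (e z) =
      mfderiv (𝓡 (n + n)) (𝓡 (n + n)) e (e.symm (e z)) (X (e.symm (e z))) := by
    rw [← h1]
    rfl
  rw [h2, e.left_inv hz]
  rfl

theorem isInvertible_mfderiv_chart (he : e ∈ IsManifold.maximalAtlas (𝓡 (n + n)) ∞ M)
    {z : M} (hz : z ∈ e.source) :
    (mfderiv (𝓡 (n + n)) (𝓡 (n + n)) e z).IsInvertible :=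
  ⟨(mdifferentiable_of_mem_maximalAtlas he).mfderiv hz, rfl⟩

theorem isInvertible_mfderiv_chart_symm (he : e ∈ IsManifold.maximalAtlas (𝓡 (n + n)) ∞ M)
    {p : EuclideanSpace ℝ (Fin (n + n))} (hp : p ∈ e.target) :
    (mfderiv (𝓡 (n + n)) (𝓡 (n + n)) e.symm p).IsInvertible :=
  ⟨(mdifferentiable_of_mem_maximalAtlas he).symm.mfderiv hp, rfl⟩

theorem dcoord_injective (he : e ∈ IsManifold.maximalAtlas (𝓡 (n + n)) ∞ M) {z : M}
    (hz : z ∈ e.source) {v w : TangentSpace (𝓡 (n + n)) z}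
    (h : ∀ k, dcoord e z v k = dcoord e z w k) : v = w := by
  refine (mdifferentiable_of_mem_maximalAtlas he).mfderiv_injective hz ?_
  apply PiLp.ext
  exact h

end

/-! ### Brackets and semisprays in natural charts. -/

section

variable {n : ℕ} {M : Type*} [TopologicalSpace M]
  [ChartedSpace (EuclideanSpace ℝ (Fin (n + n))) M]
  [IsManifold (𝓡 (n + n)) ∞ M]
  {e : OpenPartialHomeomorph M (EuclideanSpace ℝ (Fin (n + n)))}

theorem differentiableAt_chartField (he : e ∈ IsManifold.maximalAtlas (𝓡 (n + n)) ∞ M)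
    (X : VField n M) {p : EuclideanSpace ℝ (Fin (n + n))} (hp : p ∈ e.target) :
    DifferentiableAt ℝ (chartField e X) p := by
  have : IsManifold (𝓡 (n + n)) (∞ + 1) M := by
    simpa using (inferInstance : IsManifold (𝓡 (n + n)) ∞ M)
  have h : ContMDiffAt (𝓡 (n + n)) ((𝓡 (n + n)).prod 𝓘(ℝ, EuclideanSpace ℝ (Fin (n + n)))) ∞
      (fun q => Bundle.TotalSpace.mk' (EuclideanSpace ℝ (Fin (n + n)))
        (E := fun q : EuclideanSpace ℝ (Fin (n + n)) => TangentSpace (𝓡 (n + n)) q) q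
        (chartField e X q)) p :=
    ContMDiffAt.mpullback_vectorField_preimage (n := ∞) (X.contMDiff _)
      (contMDiffAt_symm_of_mem_maximalAtlas he hp) (isInvertible_mfderiv_chart_symm he hp) (by simp)
  exact (contMDiffAt_vectorSpace_iff_contDiffAt.1 h).differentiableAt (by simp)

theorem chartField_lieBr (he : e ∈ IsManifold.maximalAtlas (𝓡 (n + n)) ∞ M)
    (X Y : VField n M) {p : EuclideanSpace ℝ (Fin (n + n))} (hp : p ∈ e.target) :
    chartField e (lieBr X Y) p =
      VectorField.lieBracket ℝ (chartField e X) (chartField e Y) p := by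
  have := isManifold_minSmoothness_two n M
  have := isManifold_two n M
  have h := VectorField.mpullback_mlieBracket (I := 𝓡 (n + n)) (I' := 𝓡 (n + n))
    (f := e.symm) (x₀ := p) (n := ∞) (V := fun z => X z) (W := fun z => Y z)
    X.mdifferentiableAt Y.mdifferentiableAt
    (contMDiffAt_symm_of_mem_maximalAtlas he hp)
    (by simp only [minSmoothness_of_isRCLikeNormedField]; norm_cast)
  refine h.trans ?_
  rw [← VectorField.mlieBracketWithin_univ, VectorField.mlieBracketWithin_eq_lieBracketWithin,
    ← VectorField.lieBracketWithin_univ]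
  rfl

/-- If `V` is vertical and `S` is a semispray, then `L [V, S] = V`. -/
theorem app_lieBr_semispray {L : VForm n M} {C : VField n M} (hL : IsLStructure L C)
    {V S : VField n M} (hV : L.app V = 0) (hS : L.app S = C) : L.app (lieBr V S) = V := by
  ext1 z
  obtain ⟨e, hz, he⟩ := hL.natural_chart z
  have hVx : ∀ w ∈ e.source, ∀ i : Fin n, dcoord e w (V w) (Fin.castAdd n i) = 0 := by
    intro w hw i
    rw [← he.L_y w hw]
    have : L w (V w) = 0 := congrArg (fun X : VField n M => X w) hV
    rw [this]
    exact congrArg (fun v : EuclideanSpace ℝ (Fin (n + n)) => v _) (map_zero _)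
  have hSx : ∀ w ∈ e.source, ∀ i : Fin n,
      dcoord e w (S w) (Fin.castAdd n i) = e w (Fin.natAdd n i) := by
    intro w hw i
    rw [← he.L_y w hw, ← he.C_y w hw]
    have : L w (S w) = C w := congrArg (fun X : VField n M => X w) hS
    rw [this]
  have hp := e.map_source hz
  have hnhds := e.open_target.mem_nhds hp
  have key : ∀ i : Fin n, dcoord e z (lieBr V S z) (Fin.castAdd n i) =
      dcoord e z (V z) (Fin.natAdd n i) := by
    intro i
    rw [← chartField_apply he.mem_atlas _ hz, chartField_lieBr he.mem_atlas _ _ hp,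
      VectorField.lieBracket, ← chartField_apply he.mem_atlas _ hz]
    have comp : ∀ (X : VField n M) (v : EuclideanSpace ℝ (Fin (n + n))) (k : Fin (n + n)),
        (fderiv ℝ (chartField e X) (e z) v) k =
          fderiv ℝ (fun p => chartField e X p k) (e z) v := by
      intro X v k
      have h := ((EuclideanSpace.proj k : EuclideanSpace ℝ (Fin (n + n)) →L[ℝ] ℝ).hasFDerivAt.comp (e z)
        (differentiableAt_chartField he.mem_atlas X hp).hasFDerivAt).fderiv
      exact (DFunLike.congr_fun h v).symm
    -- The `x`-component of `[V, S]` is `V(Sˣ) - S(Vˣ)`; here `Vˣ = 0` and `Sˣ = y`, so it equals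
    -- `Vʸ`.
    have eV : (fun p => chartField e V p (Fin.castAdd n i)) =ᶠ[nhds (e z)] fun _ => 0 := by
      filter_upwards [hnhds] with p hp
      rw [← e.right_inv hp, chartField_apply he.mem_atlas _ (e.map_target hp),
        hVx _ (e.map_target hp)]
    have eS : (fun p => chartField e S p (Fin.castAdd n i)) =ᶠ[nhds (e z)]
        (EuclideanSpace.proj (Fin.natAdd n i) : EuclideanSpace ℝ (Fin (n + n)) →L[ℝ] ℝ) := by
      filter_upwards [hnhds] with p hp
      have := chartField_apply he.mem_atlas S (e.map_target hp) (Fin.castAdd n i)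
      rw [hSx _ (e.map_target hp), e.right_inv hp] at this
      exact this
    rw [PiLp.sub_apply, comp, comp, eV.fderiv_eq, eS.fderiv_eq, ContinuousLinearMap.fderiv]
    simp
  refine dcoord_injective he.mem_atlas hz fun k => ?_
  refine Fin.addCases (fun i => ?_) (fun i => ?_) k
  · exact (he.L_x z hz _ i).trans (hVx z hz i).symm
  · exact (he.L_y z hz _ i).trans (key i)

/-- Near every point there is a smooth semispray. -/
theorem exists_local_semispray {L : VForm n M} {C : VField n M} (hL : IsLStructure L C) (z : M) :
    ∃ S : ∀ w : M, TangentSpace (𝓡 (n + n)) w,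
      ContMDiffAt (𝓡 (n + n)) ((𝓡 (n + n)).prod 𝓘(ℝ, EuclideanSpace ℝ (Fin (n + n)))) ∞
        (fun w => Bundle.TotalSpace.mk' (EuclideanSpace ℝ (Fin (n + n)))
          (E := fun w : M => TangentSpace (𝓡 (n + n)) w) w (S w)) z ∧
      ∀ᶠ w in nhds z, L w (S w) = C w := by
  obtain ⟨e, hz, he⟩ := hL.natural_chart z
  -- The local semispray is `yⁱ ∂/∂xⁱ`; the zero `y`-components are an arbitrary choice, since `L`
  -- kills them.
  let A : EuclideanSpace ℝ (Fin (n + n)) →L[ℝ] EuclideanSpace ℝ (Fin (n + n)) :=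
    (EuclideanSpace.equiv (Fin (n + n)) ℝ).symm.toContinuousLinearMap.comp
      (ContinuousLinearMap.pi fun k => Fin.addCases
        (motive := fun _ => EuclideanSpace ℝ (Fin (n + n)) →L[ℝ] ℝ) (fun i => (EuclideanSpace.proj (Fin.natAdd n i) : EuclideanSpace ℝ (Fin (n + n)) →L[ℝ] ℝ))
        (fun _ => 0) k)
  have hA : ∀ p i, A p (Fin.castAdd n i) = p (Fin.natAdd n i) := by
    intro p i
    simp [A]
  have : IsManifold (𝓡 (n + n)) (∞ + 1) M := by
    simpa using (inferInstance : IsManifold (𝓡 (n + n)) ∞ M)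
  refine ⟨VectorField.mpullback (𝓡 (n + n)) (𝓡 (n + n)) e (fun p => A p), ?_, ?_⟩
  · refine ContMDiffAt.mpullback_vectorField_preimage (n := ∞) ?_
      (contMDiffAt_of_mem_maximalAtlas he.mem_atlas hz)
      (isInvertible_mfderiv_chart he.mem_atlas hz) (by simp)
    exact contMDiffAt_vectorSpace_iff_contDiffAt.2 A.contDiff.contDiffAt
  · filter_upwards [e.open_source.mem_nhds hz] with w hw
    have hd : ∀ k, dcoord e w
        (VectorField.mpullback (𝓡 (n + n)) (𝓡 (n + n)) e (fun p => A p) w) k = A (e w) k := by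
      intro k
      have h := (isInvertible_mfderiv_chart he.mem_atlas hw).self_apply_inverse (A (e w))
      exact congrArg (fun v : EuclideanSpace ℝ (Fin (n + n)) => v k) h
    refine dcoord_injective he.mem_atlas hw fun k => ?_
    refine Fin.addCases (fun i => ?_) (fun i => ?_) k
    · rw [he.L_x w hw, he.C_x w hw]
    · rw [he.L_y w hw, he.C_y w hw, hd, hA]

end

/-! ### Horizontal semisprays and the two implications. -/

section

variable {n : ℕ} {M : Type*} [TopologicalSpace M]
  [ChartedSpace (EuclideanSpace ℝ (Fin (n + n))) M] [IsManifold (𝓡 (n + n)) ∞ M]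
  {L Γ : VForm n M} {C : VField n M}

theorem VField.eq_zero_of_add_self {X : VField n M} (h : X + X = 0) : X = 0 := by
  rw [← two_smul ℝ] at h
  exact (smul_eq_zero.1 h).resolve_left two_ne_zero

theorem VField.eq_of_add_self {X Y : VField n M} (h : X + X = Y + Y) : X = Y := by
  refine sub_eq_zero.1 (VField.eq_zero_of_add_self ?_)
  rw [sub_add_sub_comm, h, sub_self]

theorem IsLStructure.apply_apply (hL : IsLStructure L C) (z : M)
    (v : TangentSpace (𝓡 (n + n)) z) : L z (L z v) = 0 := by
  have h : L z v ∈ LinearMap.range (L z).toLinearMap := ⟨v, rfl⟩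
  rw [hL.range_eq_ker z] at h
  exact h

theorem IsLStructure.app_app (hL : IsLStructure L C) (X : VField n M) : L.app (L.app X) = 0 := by
  ext1 z
  exact hL.apply_apply z (X z)

theorem IsLStructure.lie_app_app (hL : IsLStructure L C) (X Y : VField n M) :
    ⁅L.app X, L.app Y⁆ = L.app ⁅L.app X, Y⁆ + L.app ⁅X, L.app Y⁆ := by
  have h := hL.nijenhuis X Y
  simp only [fnFormForm, hL.app_app, ← VField.lie_def] at h
  -- Since `L² = 0`, `[L, L](X, Y)` is twice the difference of the two sides.
  refine VField.eq_of_add_self ?_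
  rw [← sub_eq_zero, ← h]
  abel

/-- The horizontal part of a vector depends only on its image under `L`. -/
theorem IsLConnection.add_apply_congr (hL : IsLStructure L C) (hΓ : IsLConnection L Γ) (z : M)
    {v w : TangentSpace (𝓡 (n + n)) z} (h : L z v = L z w) : v + Γ z v = w + Γ z w := by
  have hk : v - w ∈ LinearMap.ker (L z).toLinearMap := by
    change L z (v - w) = 0
    rw [map_sub, h, sub_self]
  rw [← hL.range_eq_ker z] at hk
  obtain ⟨u, hu⟩ := hk
  have hu' : L z u = v - w := hu
  have hr : Γ z (L z u) = -L z u := DFunLike.congr_fun (hΓ.right z) u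
  rw [hu', map_sub] at hr
  rw [← sub_eq_zero, add_sub_add_comm, hr, add_neg_cancel]

theorem IsLConnection.add_app_congr (hL : IsLStructure L C) (hΓ : IsLConnection L Γ)
    {X Y : VField n M} (h : L.app X = L.app Y) : X + Γ.app X = Y + Γ.app Y := by
  ext1 z
  exact hΓ.add_apply_congr hL z (congrArg (fun Z : VField n M => Z z) h)

theorem IsLConnection.app_left (hΓ : IsLConnection L Γ) (X : VField n M) :
    L.app (Γ.app X) = L.app X := by
  ext1 z
  exact DFunLike.congr_fun (hΓ.left z) (X z)

theorem IsLConnection.app_right (hΓ : IsLConnection L Γ) (X : VField n M) :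
    Γ.app (L.app X) = -L.app X := by
  ext1 z
  exact DFunLike.congr_fun (hΓ.right z) (X z)

/-- An `L`-connection has a horizontal semispray. -/
theorem IsLConnection.exists_horizontal_semispray (hL : IsLStructure L C)
    (hΓ : IsLConnection L Γ) : ∃ G : VField n M, L.app G = C ∧ Γ.app G = G := by
  have hs : ∀ z : M, ∃ v : TangentSpace (𝓡 (n + n)) z, L z v = C z := fun z => by
    obtain ⟨S, -, hS⟩ := exists_local_semispray hL z
    exact ⟨S z, hS.self_of_nhds⟩
  choose s hs using hs
  -- The choice `s` need not be continuous: `s + Γ s` depends only on `L s = C`, so near each point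
  -- it agrees with the smooth field `S + Γ S`.
  let H : VField n M := ⟨fun z => s z + Γ z (s z), fun z => by
    obtain ⟨S, hS, hLS⟩ := exists_local_semispray hL z
    refine (hS.add_section ((Γ.contMDiff z).clm_bundle_apply hS)).congr_of_eventuallyEq ?_
    filter_upwards [hLS] with w hw
    exact congrArg (Bundle.TotalSpace.mk' _ w)
      (hΓ.add_apply_congr hL w ((hs w).trans hw.symm))⟩
  have hLH : L.app H = C + C := by
    ext1 z
    have h : L z (Γ z (s z)) = L z (s z) := DFunLike.congr_fun (hΓ.left z) (s z)
    change L z (s z + Γ z (s z)) = C z + C z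
    rw [map_add, h, hs]
  -- `H` and `2 s` have the same image under `L`, hence the same horizontal part.
  have hΓH : H + Γ.app H = H + H := by
    ext1 z
    have h : L z (H z) = L z (s z + s z) := by
      rw [map_add, hs]
      exact congrArg (fun Z : VField n M => Z z) hLH
    refine (hΓ.add_apply_congr hL z h).trans ?_
    change s z + s z + Γ z (s z + s z) = s z + Γ z (s z) + (s z + Γ z (s z))
    rw [map_add, add_add_add_comm]
  refine ⟨(1 / 2 : ℝ) • H, ?_, ?_⟩
  · rw [VForm.app_smul, hLH, ← two_smul ℝ C, smul_smul]
    norm_num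
  · rw [VForm.app_smul, add_left_cancel hΓH]

/-- `[C, L] = -L`. -/
theorem IsLStructure.lie_app (hL : IsLStructure L C) {G : VField n M} (hG : L.app G = C)
    (X : VField n M) : ⁅C, L.app X⁆ = L.app ⁅C, X⁆ - L.app X := by
  have h := hL.lie_app_app G X
  rw [hG, ← lie_skew G (L.app X), VForm.app_neg, VField.lie_def (L.app X) G,
    app_lieBr_semispray hL (hL.app_app X) hG] at h
  rw [h, sub_eq_add_neg]

/-- Both `[C, G]` and `G` are fixed by `Γ` and have image `C` under `L`; a horizontal vector is
determined by its image under `L`. -/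
theorem IsLConnection.lie_horizontal_semispray (hL : IsLStructure L C) (hΓ : IsLConnection L Γ)
    (hΓC : IsHomogeneousOne C Γ) {G : VField n M} (hG : L.app G = C) (hΓG : Γ.app G = G) :
    ⁅C, G⁆ = G := by
  have h1 : Γ.app ⁅C, G⁆ = ⁅C, G⁆ := by
    have h := hΓC G
    rw [fnFieldForm, hΓG, sub_eq_zero] at h
    exact h.symm
  have h2 : L.app ⁅C, G⁆ = L.app G := by
    have h := hL.lie_app hG G
    rw [hG, lie_self] at h
    rw [hG]
    exact sub_eq_zero.1 h.symm
  have h3 := hΓ.add_app_congr hL h2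
  rw [h1, hΓG] at h3
  exact VField.eq_of_add_self h3

theorem IsConservative.fnFormForm_eq_zero (hL : IsLStructure L C) (h : IsConservative L C Γ)
    (X Y : VField n M) : fnFormForm L Γ X Y = 0 := by
  obtain ⟨G, -, hG⟩ := h
  exact bracket_bracket_eq_zero L.toAddHom hL.app_app hL.lie_app_app G Γ.app hG X Y

theorem IsLConnection.isConservative_of_fnFormForm_eq_zero (hL : IsLStructure L C)
    (hΓ : IsLConnection L Γ) (hΓC : IsHomogeneousOne C Γ)
    (hT : ∀ X Y : VField n M, fnFormForm L Γ X Y = 0) : IsConservative L C Γ := by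
  obtain ⟨G, hG, hΓG⟩ := hΓ.exists_horizontal_semispray hL
  refine ⟨G, ⟨hG, hΓ.lie_horizontal_semispray hL hΓC hG hΓG⟩, fun X => ?_⟩
  have h0 := hT X G
  have h1 : ⁅Γ.app X, C⁆ = Γ.app ⁅X, C⁆ := by
    have h := hΓC X
    rw [fnFieldForm, sub_eq_zero] at h
    rw [← lie_skew (Γ.app X) C, ← lie_skew X C, VForm.app_neg]
    exact congrArg Neg.neg h
  -- `Γ X - X` is vertical because `L Γ = L`.
  have h2 : L.app ⁅Γ.app X, G⁆ = Γ.app X - X + L.app ⁅X, G⁆ := by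
    have h := app_lieBr_semispray hL (V := Γ.app X - X)
      (by rw [VForm.app_sub, hΓ.app_left, sub_self]) hG
    rw [← VField.lie_def, sub_lie, VForm.app_sub] at h
    exact sub_eq_iff_eq_add.1 h
  -- `[L X, G]` and `X` have the same image under `L`, hence the same horizontal part.
  have h3 : Γ.app ⁅L.app X, G⁆ = X + Γ.app X - ⁅L.app X, G⁆ := by
    have h := hΓ.add_app_congr hL (app_lieBr_semispray hL (hL.app_app X) hG)
    rw [← h]
    exact (add_sub_cancel_left _ _).symm
  simp only [fnFormForm, ← VField.lie_def, hΓG, hG, hΓ.app_left, hΓ.app_right, h1, h2, h3] at h0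
  refine VField.eq_of_add_self ?_
  rw [fnFormField, ← VField.lie_def, ← VField.lie_def, eq_comm, ← sub_eq_zero, ← h0]
  abel

end

theorem theorem4 (n : ℕ) (hn : 1 ≤ n) (M : Type*) [TopologicalSpace M] [T2Space M]
    [ParacompactSpace M] [ChartedSpace (EuclideanSpace ℝ (Fin (n + n))) M]
    [IsManifold (𝓡 (n + n)) ∞ M] (L : VForm n M) (C : VField n M) (hL : IsLStructure L C)
    (Γ : VForm n M) (hΓ : IsLConnection L Γ) (hΓC : IsHomogeneousOne C Γ) :
    (IsConservative L C Γ ↔ ∀ X Y : VField n M, fnFormForm L Γ X Y = 0) ∧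
    ((∀ X Y : VField n M, fnFormForm L Γ X Y = 0) ↔
      ∀ X Y : VField n M, torsion L Γ X Y = 0) := by
  refine ⟨⟨fun h => h.fnFormForm_eq_zero hL, hΓ.isConservative_of_fnFormForm_eq_zero hL hΓC⟩,
    forall₂_congr fun X Y => ?_⟩
  rw [torsion, smul_eq_zero]
  norm_num
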